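/- Let $k$ be a field. For a finite-dimensional $k$-vector space $V$, let $\wedge(V^*)$ be the exterior algebra of the dual space $V^*$, regard $k$ as a left $\wedge(V^*)$-module through the augmentation $\wedge(V^*)\to k$ that kills $V^*$, and let $S^tV$ denote the degree-$t$ component of the symmetric algebra of $V$. Then for every integer $t\ge 0$ there is an isomorphism of $k$-vector spaces $$e_V\colon \mathrm{Ext}^t_{\wedge(V^*)}(k,k)\;\xrightarrow{\ \sim\ }\;S^tV ,$$ natural in $V$: for every linear map $f\colon V\to W$ of finite-dimensional $k$-vector spaces, $e_W\circ f_* = S^t(f)\circ e_V$, where $f_*\colon \mathrm{Ext}^t_{\wedge(V^*)}(k,k)\to \mathrm{Ext}^t_{\wedge(W^*)}(k,k)$ is restriction of scalars along the algebra homomorphism $\wedge(f^*)\colon\wedge(W^*)\to\wedge(V^*)$ induced by the transpose $f^*\colon W^*\to V^*$. In particular, $e_V$ is $GL(V)$-equivariant. -/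

import Mathlib

open CategoryTheory

universe u

noncomputable section

/-! ### Symmetric powers -/

/-- The symmetric power `S^t V`: the homogeneous component of degree `t` of the symmetric algebra,
i.e. the span of all products of `t` elements of `V` (for `t = 0` it is the span of `1`). -/
def SymPow (k V : Type u) [Field k] [AddCommGroup V] [Module k V] (t : ℕ) :
    Submodule k (SymmetricAlgebra k V) :=
  LinearMap.range (SymmetricAlgebra.ι k V) ^ t

/-- The algebra map `S^* V → S^* W` induced by a linear map `V → W`. -/
def symAlgMap {k V W : Type u} [Field k] [AddCommGroup V] [Module k V]
    [AddCommGroup W] [Module k W] (f : V →ₗ[k] W) :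
    SymmetricAlgebra k V →ₐ[k] SymmetricAlgebra k W :=
  SymmetricAlgebra.lift (SymmetricAlgebra.ι k W ∘ₗ f)

theorem symAlgMap_mem {k V W : Type u} [Field k] [AddCommGroup V] [Module k V]
    [AddCommGroup W] [Module k W] (f : V →ₗ[k] W) (t : ℕ) :
    ∀ x ∈ SymPow k V t, (symAlgMap f).toLinearMap x ∈ SymPow k W t := by
  intro x hx
  have h : (SymPow k V t).map (symAlgMap f).toLinearMap ≤ SymPow k W t := by
    rw [SymPow, Submodule.map_pow]
    refine pow_le_pow_left' ?_ t
    rintro _ ⟨_, ⟨v, rfl⟩, rfl⟩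
    exact ⟨f v, by simp [symAlgMap]⟩
  exact h ⟨x, hx, rfl⟩

/-- The linear map `S^t V → S^t W` induced by a linear map `V → W`. -/
def symPowMap {k V W : Type u} [Field k] [AddCommGroup V] [Module k V]
    [AddCommGroup W] [Module k W] (f : V →ₗ[k] W) (t : ℕ) :
    SymPow k V t →ₗ[k] SymPow k W t :=
  (symAlgMap f).toLinearMap.restrict (symAlgMap_mem f t)

/-! ### The Ext groups of the trivial module over the exterior algebra -/

/-- Restriction of scalars along a homomorphism of (possibly noncommutative) rings is exact. -/
theorem restrictScalars_preserves {R S : Type u} [Ring R] [Ring S] (φ : R →+* S) :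
    Limits.PreservesFiniteLimits (ModuleCat.restrictScalars.{u} φ) ∧
      Limits.PreservesFiniteColimits (ModuleCat.restrictScalars.{u} φ) := by
  refine ((Functor.exact_tfae (ModuleCat.restrictScalars.{u} φ)).out 1 3).mp ?_
  intro T h
  rw [ShortComplex.ShortExact.moduleCat_exact_iff_function_exact] at h ⊢
  exact h

instance restrictScalarsPreservesFiniteLimits {R S : Type u} [Ring R] [Ring S] (φ : R →+* S) :
    Limits.PreservesFiniteLimits (ModuleCat.restrictScalars.{u} φ) :=
  (restrictScalars_preserves φ).1

instance restrictScalarsPreservesFiniteColimits {R S : Type u} [Ring R] [Ring S] (φ : R →+* S) :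
    Limits.PreservesFiniteColimits (ModuleCat.restrictScalars.{u} φ) :=
  (restrictScalars_preserves φ).2

/-- The exterior algebra `∧(V^*)` on the dual space of `V`. -/
abbrev DualExt (k V : Type u) [Field k] [AddCommGroup V] [Module k V] : Type u :=
  ExteriorAlgebra k (Module.Dual k V)

/-- The augmentation `∧(V^*) → k`, which kills `V^*`. -/
abbrev dualExtAug (k V : Type u) [Field k] [AddCommGroup V] [Module k V] :
    DualExt k V →ₐ[k] k :=
  ExteriorAlgebra.algebraMapInv

/-- The field `k` as a (left) module over `∧(V^*)` through the augmentation. -/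
abbrev trivialModule (k V : Type u) [Field k] [AddCommGroup V] [Module k V] :
    ModuleCat.{u} (DualExt k V) :=
  (ModuleCat.restrictScalars (dualExtAug k V).toRingHom).obj (ModuleCat.of k k)

/-- The algebra map `∧(W^*) → ∧(V^*)` induced by the transpose of a linear map `V → W`. -/
abbrev dualExtMap {k V W : Type u} [Field k] [AddCommGroup V] [Module k V]
    [AddCommGroup W] [Module k W] (f : V →ₗ[k] W) : DualExt k W →ₐ[k] DualExt k V :=
  ExteriorAlgebra.map f.dualMap

theorem dualExtAug_comp_map {k V W : Type u} [Field k] [AddCommGroup V] [Module k V]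
    [AddCommGroup W] [Module k W] (f : V →ₗ[k] W) :
    (dualExtAug k W).toRingHom =
      (dualExtAug k V).toRingHom.comp (dualExtMap f).toRingHom := by
  have h : dualExtAug k W = (dualExtAug k V).comp (dualExtMap f) := by
    refine ExteriorAlgebra.hom_ext ?_
    ext w
    simp [dualExtAug, ExteriorAlgebra.algebraMapInv]
  rw [h]
  rfl

/-- Restricting the trivial module of `∧(V^*)` along `∧(W^*) → ∧(V^*)` gives the trivial module of
`∧(W^*)`; the isomorphism is the identity on the underlying space `k`. -/
def trivialModuleIso {k V W : Type u} [Field k] [AddCommGroup V] [Module k V]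
    [AddCommGroup W] [Module k W] (f : V →ₗ[k] W) :
    trivialModule k W ≅
      (ModuleCat.restrictScalars (dualExtMap f).toRingHom).obj (trivialModule k V) :=
  ModuleCat.restrictScalarsComp'App (dualExtMap f).toRingHom (dualExtAug k V).toRingHom
    (dualExtAug k W).toRingHom (dualExtAug_comp_map f) (ModuleCat.of k k)

/-- `Ext^t_{∧(V^*)}(k, k)`, computed in the category of modules over `∧(V^*)`. -/
abbrev ExtTriv (k V : Type u) [Field k] [AddCommGroup V] [Module k V] (t : ℕ) : Type u :=
  Abelian.Ext.{u} (trivialModule k V) (trivialModule k V) t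

/-- The map `Ext^t_{∧(V^*)}(k, k) → Ext^t_{∧(W^*)}(k, k)` induced by a linear map `V → W`:
restriction of scalars along `∧(W^*) → ∧(V^*)`, followed by the identification of the restricted
module `k` with `k` in both arguments. -/
def extTrivMap {k V W : Type u} [Field k] [AddCommGroup V] [Module k V]
    [AddCommGroup W] [Module k W] (f : V →ₗ[k] W) (t : ℕ) (x : ExtTriv k V t) :
    ExtTriv k W t :=
  (Abelian.Ext.mk₀ (trivialModuleIso f).hom).comp
    ((x.mapExactFunctor (ModuleCat.restrictScalars (dualExtMap f).toRingHom)).comp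
      (Abelian.Ext.mk₀ (trivialModuleIso f).inv) (add_zero t)) (zero_add t)

end

/-!
The isomorphism comes from an injective Koszul resolution of the trivial module that is visibly
functorial in `V`. Write `A = ∧(V^*)`, let `v_i` be a basis of `V` and `φ_i` the dual basis. The
modules `I_t = Hom_k(A, S^t V)`, on which `A` acts by right multiplication in the argument, are
coinduced from `k` and hence injective (the instance on `CofreeModule`), and the differential is
`(d h)(a) = ∑ i, v_i · h(φ_i a)` (`koszulD`). It squares to zero because the `v_i` commute and the
`φ_i` anticommute.

Exactness (`exists_koszulD_eq`, `eq_aug_smul_of_koszulD_zero`) has to hold in every characteristic,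
so the Euler homotopy, which divides by the degree, is not available. Instead there is one partial
homotopy `h_i` for each basis vector, combining division by `v_i` in `S^* V` with contraction by
`v_i` in `A` (`koszulHomotopy`). For a cocycle `z`, the cohomologous cocycle `z - d h_i z` has
values in which no monomial involves `v_i`, and doing this for all `i` leaves nothing in positive
degree.

Let `Z_t` be the cocycles of degree `t`, so that `Z_0 = k`. Splicing the short exact sequences
`0 → Z_t → I_t → Z_{t+1} → 0` gives a class in `Ext^t(Z_t, k)` (`koszulClass`). Composition with it
is a bijection `Hom(k, Z_t) → Ext^t(k, k)`, since the `I_t` are injective and every map `k → I_t`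
takes values in multiples of the augmentation, on which `d` vanishes. For the same reason
`Hom(k, Z_t) = S^t V` (`symPowEquivHom`).

For `f : V → W`, the maps `h ↦ S^t(f) ∘ h ∘ ∧(f^*)` are a morphism from the restriction of the
resolution for `V` to the resolution for `W` (`koszulD_koszulMap`), and naturality of extension
classes then carries the naturality of `Hom(k, Z_t) = S^t V` over to `Ext`
(`koszulClass_naturality`).
-/

noncomputable section

/-! ### Multiplication and division by vectors in symmetric powers -/

section SymmetricPowers

variable {k V W : Type u} [Field k] [AddCommGroup V] [Module k V] [AddCommGroup W] [Module k W]

/-- In coordinates, `S^t V` is the space of homogeneous polynomials of degree `t`. -/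
theorem mem_symPow_iff_isHomogeneous {ι : Type*} (b : Module.Basis ι k V) {t : ℕ}
    {s : SymmetricAlgebra k V} :
    s ∈ SymPow k V t ↔ (SymmetricAlgebra.equivMvPolynomial b s).IsHomogeneous t := by
  have h : (SymPow k V t).map (SymmetricAlgebra.equivMvPolynomial b).toLinearMap =
      MvPolynomial.homogeneousSubmodule ι k t := by
    rw [SymPow, ← MvPolynomial.homogeneousSubmodule_one_pow,
      MvPolynomial.homogeneousSubmodule_one_eq_span_X]
    refine (Submodule.map_pow _ (SymmetricAlgebra.equivMvPolynomial b).toAlgHom t).trans ?_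
    congr 1
    rw [LinearMap.range_eq_map, ← b.span_eq, ← Submodule.map_comp, Submodule.map_span,
      ← Set.range_comp]
    congr 2
    ext i : 1
    exact SymmetricAlgebra.equivMvPolynomial_ι_apply b i
  rw [← MvPolynomial.mem_homogeneousSubmodule, ← h]
  exact ((SymmetricAlgebra.equivMvPolynomial b).injective.mem_set_image (s := SymPow k V t)).symm

/-- Multiplication by a vector `v`, as a map `S^t V → S^{t+1} V`. -/
def symPowMul (t : ℕ) : V →ₗ[k] SymPow k V t →ₗ[k] SymPow k V (t + 1) :=
  LinearMap.mk₂ k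
    (fun v s => ⟨SymmetricAlgebra.ι k V v * s, by
      rw [SymPow, pow_succ']
      exact Submodule.mul_mem_mul ⟨v, rfl⟩ s.2⟩)
    (fun v w s => Subtype.ext (by simp [add_mul]))
    (fun c v s => Subtype.ext (by simp))
    (fun v s s' => Subtype.ext (by simp [mul_add]))
    (fun c v s => Subtype.ext (by simp))

@[simp]
theorem coe_symPowMul (t : ℕ) (v : V) (s : SymPow k V t) :
    (symPowMul t v s : SymmetricAlgebra k V) = SymmetricAlgebra.ι k V v * s := rfl

theorem symPowMul_comm (t : ℕ) (v w : V) (s : SymPow k V t) :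
    symPowMul (t + 1) v (symPowMul t w s) = symPowMul (t + 1) w (symPowMul t v s) :=
  Subtype.ext (by simp [mul_left_comm])

@[simp]
theorem coe_symPowMap (f : V →ₗ[k] W) (t : ℕ) (s : SymPow k V t) :
    (symPowMap f t s : SymmetricAlgebra k W) = symAlgMap f s := rfl

theorem symPowMap_symPowMul (f : V →ₗ[k] W) (t : ℕ) (v : V) (s : SymPow k V t) :
    symPowMap f (t + 1) (symPowMul t v s) = symPowMul t (f v) (symPowMap f t s) :=
  Subtype.ext (by simp [symAlgMap])

/-- The isomorphism `k ≃ S^0 V`. -/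
def symPowZeroEquiv (k V : Type u) [Field k] [AddCommGroup V] [Module k V] :
    k ≃ₗ[k] SymPow k V 0 :=
  LinearEquiv.ofBijective
    ((Algebra.linearMap k (SymmetricAlgebra k V)).codRestrict _ fun c => by
      rw [SymPow, pow_zero]
      exact Submodule.mem_one.mpr ⟨c, rfl⟩)
    ⟨fun c c' h => (SymmetricAlgebra.algebraMap_inj V c c').mp (congrArg Subtype.val h),
      fun ⟨s, hs⟩ => by
        rw [SymPow, pow_zero] at hs
        obtain ⟨c, rfl⟩ := Submodule.mem_one.mp hs
        exact ⟨c, rfl⟩⟩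

@[simp]
theorem coe_symPowZeroEquiv (c : k) :
    (symPowZeroEquiv k V c : SymmetricAlgebra k V) = algebraMap k _ c := rfl

theorem symPowMap_symPowZeroEquiv (f : V →ₗ[k] W) (c : k) :
    symPowMap f 0 (symPowZeroEquiv k V c) = symPowZeroEquiv k W c :=
  Subtype.ext (by simp)

variable {ι : Type*} (b : Module.Basis ι k V)

/-- Division by the `i`-th basis vector, as a map `S^{t+1} V → S^t V`: in the monomial basis of the
symmetric algebra it kills the monomials that do not involve `b i`. -/
def symPowDiv (i : ι) (t : ℕ) : SymPow k V (t + 1) →ₗ[k] SymPow k V t where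
  toFun s := ⟨(SymmetricAlgebra.equivMvPolynomial b).symm
      ((SymmetricAlgebra.equivMvPolynomial b s).divMonomial (Finsupp.single i 1)), by
    rw [mem_symPow_iff_isHomogeneous b, AlgEquiv.apply_symm_apply]
    intro m hm
    rw [MvPolynomial.coeff_divMonomial] at hm
    have h := (mem_symPow_iff_isHomogeneous b).mp s.2 hm
    rw [map_add, Finsupp.weight_single] at h
    simp only [Pi.one_apply, smul_eq_mul, mul_one] at h
    omega⟩
  map_add' s s' := Subtype.ext (by simp [MvPolynomial.add_divMonomial])
  map_smul' c s := Subtype.ext (by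
    apply (SymmetricAlgebra.equivMvPolynomial b).injective
    ext m
    simp [MvPolynomial.coeff_divMonomial])

theorem equivMvPolynomial_symPowDiv (i : ι) (t : ℕ) (s : SymPow k V (t + 1)) :
    SymmetricAlgebra.equivMvPolynomial b (symPowDiv b i t s) =
      (SymmetricAlgebra.equivMvPolynomial b s).divMonomial (Finsupp.single i 1) :=
  AlgEquiv.apply_symm_apply _ _

theorem symPowDiv_symPowMul_self (i : ι) (t : ℕ) (s : SymPow k V t) :
    symPowDiv b i t (symPowMul t (b i) s) = s := by
  apply Subtype.ext
  apply (SymmetricAlgebra.equivMvPolynomial b).injective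
  rw [equivMvPolynomial_symPowDiv, coe_symPowMul, map_mul,
    SymmetricAlgebra.equivMvPolynomial_ι_apply, MvPolynomial.X_mul_divMonomial]

theorem symPowDiv_symPowMul_of_ne {i j : ι} (hij : i ≠ j) (t : ℕ) (s : SymPow k V (t + 1)) :
    symPowDiv b i (t + 1) (symPowMul (t + 1) (b j) s) = symPowMul t (b j) (symPowDiv b i t s) := by
  classical
  apply Subtype.ext
  apply (SymmetricAlgebra.equivMvPolynomial b).injective
  rw [equivMvPolynomial_symPowDiv, coe_symPowMul, coe_symPowMul, map_mul, map_mul,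
    SymmetricAlgebra.equivMvPolynomial_ι_apply, equivMvPolynomial_symPowDiv]
  ext m
  rw [MvPolynomial.coeff_divMonomial, MvPolynomial.coeff_X_mul', MvPolynomial.coeff_X_mul']
  have hj : j ∈ (Finsupp.single i 1 + m).support ↔ j ∈ m.support := by
    simp [hij]
  by_cases h : j ∈ m.support
  · rw [if_pos h, if_pos (hj.mpr h), MvPolynomial.coeff_divMonomial]
    congr 1
    refine (add_tsub_assoc_of_le ?_ _)
    rw [Finsupp.single_le_iff]
    exact Nat.one_le_iff_ne_zero.mpr (Finsupp.mem_support_iff.mp h)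
  · rw [if_neg h, if_neg (mt hj.mp h)]

/-- No monomial of `s`, in the monomial basis of the symmetric algebra, involves `b i`. -/
def FreeOfBasisVector (i : ι) {t : ℕ} (s : SymPow k V t) : Prop :=
  ∀ m : ι →₀ ℕ, m i ≠ 0 → (SymmetricAlgebra.equivMvPolynomial b s).coeff m = 0

theorem coeff_sub_symPowMul_symPowDiv (i : ι) (t : ℕ) (s : SymPow k V (t + 1)) (m : ι →₀ ℕ) :
    (SymmetricAlgebra.equivMvPolynomial b
      (s - symPowMul t (b i) (symPowDiv b i t s) : SymPow k V (t + 1))).coeff m =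
      if m i = 0 then (SymmetricAlgebra.equivMvPolynomial b s).coeff m else 0 := by
  have h := MvPolynomial.divMonomial_add_modMonomial_single
    (SymmetricAlgebra.equivMvPolynomial b (s : SymmetricAlgebra k V)) i
  rw [Submodule.coe_sub, map_sub, coe_symPowMul, map_mul, equivMvPolynomial_symPowDiv,
    SymmetricAlgebra.equivMvPolynomial_ι_apply, sub_eq_of_eq_add' h.symm]
  split_ifs with hm
  · refine MvPolynomial.coeff_modMonomial_of_not_le _ fun hle => ?_
    rw [Finsupp.single_le_iff] at hle
    omega
  · refine MvPolynomial.coeff_modMonomial_of_le _ ?_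
    rw [Finsupp.single_le_iff]
    omega

theorem freeOfBasisVector_sub_self (i : ι) (t : ℕ) (s : SymPow k V (t + 1)) :
    FreeOfBasisVector b i (s - symPowMul t (b i) (symPowDiv b i t s)) := fun m hm => by
  rw [coeff_sub_symPowMul_symPowDiv, if_neg hm]

theorem FreeOfBasisVector.sub {i j : ι} {t : ℕ} {s : SymPow k V (t + 1)}
    (h : FreeOfBasisVector b j s) :
    FreeOfBasisVector b j (s - symPowMul t (b i) (symPowDiv b i t s)) := fun m hm => by
  rw [coeff_sub_symPowMul_symPowDiv, h m hm, ite_self]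

theorem eq_zero_of_forall_freeOfBasisVector {t : ℕ} {s : SymPow k V (t + 1)}
    (h : ∀ i, FreeOfBasisVector b i s) : s = 0 := by
  apply Subtype.ext
  apply (SymmetricAlgebra.equivMvPolynomial b).injective
  ext m
  simp only [ZeroMemClass.coe_zero, map_zero, MvPolynomial.coeff_zero]
  by_cases hm : m = 0
  · exact ((mem_symPow_iff_isHomogeneous b).mp s.2).coeff_eq_zero (by simp [hm])
  · obtain ⟨i, hi⟩ := Finsupp.ne_iff.mp hm
    exact h i m hi

theorem symPowDiv_symPowMul_zero_of_ne {i j : ι} (hij : i ≠ j) (s : SymPow k V 0) :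
    symPowDiv b i 0 (symPowMul 0 (b j) s) = 0 := by
  classical
  obtain ⟨c, rfl⟩ := (symPowZeroEquiv k V).surjective s
  apply Subtype.ext
  apply (SymmetricAlgebra.equivMvPolynomial b).injective
  rw [equivMvPolynomial_symPowDiv, coe_symPowMul, map_mul,
    SymmetricAlgebra.equivMvPolynomial_ι_apply, coe_symPowZeroEquiv, AlgEquiv.commutes]
  ext m
  have h : Finsupp.single j 1 ≠ Finsupp.single i 1 + m := fun h => by
    have := DFunLike.congr_fun h i
    simp [hij.symm] at this
    omega
  rw [MvPolynomial.coeff_divMonomial, MvPolynomial.algebraMap_eq, mul_comm,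
    MvPolynomial.coeff_C_mul, MvPolynomial.coeff_X, if_neg h]
  simp

end SymmetricPowers

/-! ### Coinduced modules -/

section Cofree

/-- The `A`-module `Hom_k(A, M)` coinduced from a `k`-module `M`, where `A` acts by right
multiplication in the argument. -/
def CofreeModule (k A M : Type u) [Field k] [Ring A] [Algebra k A] [AddCommGroup M] [Module k M] :
    Type u :=
  A →ₗ[k] M

namespace CofreeModule

variable {k A M : Type u} [Field k] [Ring A] [Algebra k A] [AddCommGroup M] [Module k M]

instance : AddCommGroup (CofreeModule k A M) := inferInstanceAs (AddCommGroup (A →ₗ[k] M))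

instance : FunLike (CofreeModule k A M) A M := inferInstanceAs (FunLike (A →ₗ[k] M) A M)

instance : LinearMapClass (CofreeModule k A M) k A M :=
  inferInstanceAs (LinearMapClass (A →ₗ[k] M) k A M)

@[ext]
theorem ext {h h' : CofreeModule k A M} (H : ∀ a, h a = h' a) : h = h' := LinearMap.ext H

@[simp] theorem zero_apply (a : A) : (0 : CofreeModule k A M) a = 0 := rfl
@[simp] theorem add_apply (h h' : CofreeModule k A M) (a : A) : (h + h') a = h a + h' a := rfl
@[simp] theorem sub_apply (h h' : CofreeModule k A M) (a : A) : (h - h') a = h a - h' a := rfl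

instance : Module A (CofreeModule k A M) where
  smul a h := LinearMap.comp (show A →ₗ[k] M from h) (LinearMap.mulRight k a)
  one_smul h := ext fun x => congrArg h (mul_one x)
  mul_smul a c h := ext fun x => congrArg h (mul_assoc x a c).symm
  smul_zero _ := rfl
  smul_add _ _ _ := rfl
  add_smul a c h := ext fun x => (congrArg h (mul_add x a c)).trans (map_add h _ _)
  zero_smul h := ext fun x => (congrArg h (mul_zero x)).trans (map_zero h)

@[simp] theorem smul_apply (a : A) (h : CofreeModule k A M) (x : A) : (a • h) x = h (x * a) := rfl

theorem algebraMap_smul_apply_one (c : k) (h : CofreeModule k A M) :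
    (algebraMap k A c • h) 1 = c • h 1 := by
  rw [smul_apply, one_mul, Algebra.algebraMap_eq_smul_one, map_smul]

/-- Coinduced modules over an algebra over a field are injective: a map into `Hom_k(A, M)` is the
same as a `k`-linear map into `M`. -/
instance : Module.Injective A (CofreeModule k A M) where
  out X Y _ _ _ _ f hf g := by
    let := Module.restrictScalars k A X
    let := Module.restrictScalars k A Y
    have := IsScalarTower.restrictScalars k A X
    have := IsScalarTower.restrictScalars k A Y
    let g₁ : X →ₗ[k] M :=
      { toFun x := g x 1
        map_add' := by simp
        map_smul' c x := by
          rw [← algebraMap_smul A c x, map_smul, algebraMap_smul_apply_one, RingHom.id_apply] }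
    obtain ⟨r, hr⟩ := (f.restrictScalars k).exists_leftInverse_of_injective
      (LinearMap.ker_eq_bot.mpr hf)
    have hr (x : X) : r (f x) = x := LinearMap.congr_fun hr x
    refine ⟨{ toFun y := show A →ₗ[k] M from
                { toFun a := g₁ (r (a • y))
                  map_add' a c := by rw [add_smul, map_add, map_add]
                  map_smul' c a := by rw [smul_assoc, map_smul, map_smul, RingHom.id_apply] }
              map_add' y y' := ext fun a => ?_
              map_smul' c y := ext fun a => ?_ }, fun x => ext fun a => ?_⟩
    · change g₁ (r (a • (y + y'))) = g₁ (r (a • y)) + g₁ (r (a • y'))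
      rw [smul_add, map_add, map_add]
    · change g₁ (r (a • c • y)) = g₁ (r ((a * c) • y))
      rw [mul_smul]
    · change g (r (a • f x)) 1 = g x a
      rw [← map_smul, hr, map_smul, smul_apply, one_mul]

end CofreeModule

end Cofree

/-! ### The Koszul resolution -/

section Koszul

variable {k V W : Type u} [Field k] [AddCommGroup V] [Module k V] [AddCommGroup W] [Module k W]

/-- A linear function on `∧(V^*)` which vanishes on all left multiples of elements of `V^*` is the
augmentation, up to a constant. -/
theorem eq_aug_smul_of_ι_mul_eq_zero {M : Type*} [AddCommGroup M] [Module k M]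
    (h : DualExt k V →ₗ[k] M) (H : ∀ φ a, h (ExteriorAlgebra.ι k φ * a) = 0) (a : DualExt k V) :
    h a = dualExtAug k V a • h 1 := by
  -- This form of the claim is stable under products.
  suffices ∀ c, h (a * c) = dualExtAug k V a • h c by simpa using this 1
  induction a using ExteriorAlgebra.induction with
  | algebraMap r => intro c; simp [← Algebra.smul_def]
  | ι φ => intro c; simp [H, ExteriorAlgebra.algebraMapInv]
  | mul a a' ha ha' => intro c; rw [mul_assoc, ha, ha', map_mul, mul_smul]
  | add a a' ha ha' => intro c; rw [add_mul, map_add, ha, ha', map_add, add_smul]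

/-- The counterpart of `eq_aug_smul_of_ι_mul_eq_zero` for right multiples. -/
theorem eq_aug_smul_of_mul_ι_eq_zero {M : Type*} [AddCommGroup M] [Module k M]
    (h : DualExt k V →ₗ[k] M) (H : ∀ φ a, h (a * ExteriorAlgebra.ι k φ) = 0) (a : DualExt k V) :
    h a = dualExtAug k V a • h 1 := by
  suffices ∀ c, h (c * a) = dualExtAug k V a • h c by simpa using this 1
  induction a using ExteriorAlgebra.induction with
  | algebraMap r => intro c; simp [← Algebra.commutes, ← Algebra.smul_def]
  | ι φ => intro c; simp [H, ExteriorAlgebra.algebraMapInv]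
  | mul a a' ha ha' => intro c; rw [← mul_assoc, ha', ha, map_mul, smul_smul,
      mul_comm (dualExtAug k V a)]
  | add a a' ha ha' => intro c; rw [mul_add, map_add, ha, ha', map_add, add_smul]

/-- The term `Hom_k(∧(V^*), S^t V)` of the Koszul resolution of `k` by injective
`∧(V^*)`-modules. -/
abbrev KoszulTerm (k V : Type u) [Field k] [AddCommGroup V] [Module k V] (t : ℕ) : Type u :=
  CofreeModule k (DualExt k V) (SymPow k V t)

variable {ι : Type*} (b : Module.Basis ι k V)

/-- The contraction `(h, a) ↦ (h(v_i ⌟ a)) / v_i` of the Koszul resolution in the direction of one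
basis vector. -/
def koszulHomotopy (i : ι) (t : ℕ) (h : KoszulTerm k V (t + 1)) : KoszulTerm k V t :=
  symPowDiv b i t ∘ₗ (show DualExt k V →ₗ[k] SymPow k V (t + 1) from h) ∘ₗ
    CliffordAlgebra.contractLeft (Module.Dual.eval k V (b i))

theorem koszulHomotopy_apply (i : ι) (t : ℕ) (h : KoszulTerm k V (t + 1)) (a : DualExt k V) :
    koszulHomotopy b i t h a = symPowDiv b i t
      (h (CliffordAlgebra.contractLeft (Q := 0) (Module.Dual.eval k V (b i)) a)) := rfl

theorem contractLeft_coord_mul_self (i : ι) (a : DualExt k V) :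
    CliffordAlgebra.contractLeft (Q := 0) (Module.Dual.eval k V (b i))
      (ExteriorAlgebra.ι k (b.coord i) * a) =
    a - ExteriorAlgebra.ι k (b.coord i) *
      CliffordAlgebra.contractLeft (Q := 0) (Module.Dual.eval k V (b i)) a := by
  refine (CliffordAlgebra.contractLeft_ι_mul (Q := 0) _ _ _).trans ?_
  simp

theorem contractLeft_coord_mul_of_ne {i j : ι} (hij : i ≠ j) (a : DualExt k V) :
    CliffordAlgebra.contractLeft (Q := 0) (Module.Dual.eval k V (b i))
      (ExteriorAlgebra.ι k (b.coord j) * a) =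
    - (ExteriorAlgebra.ι k (b.coord j) *
      CliffordAlgebra.contractLeft (Q := 0) (Module.Dual.eval k V (b i)) a) := by
  refine (CliffordAlgebra.contractLeft_ι_mul (Q := 0) _ _ _).trans ?_
  simp [hij]

variable [Fintype ι]

/-- The Koszul differential: `(d h)(a) = ∑ i, v_i · h(φ_i a)`, where `v_i` is a basis of `V` and
`φ_i` is the dual basis. It does not depend on the basis, see `koszulD_koszulMap`. -/
def koszulD (t : ℕ) : KoszulTerm k V t →ₗ[DualExt k V] KoszulTerm k V (t + 1) where
  toFun h := show DualExt k V →ₗ[k] SymPow k V (t + 1) from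
    ∑ i, symPowMul t (b i) ∘ₗ (show DualExt k V →ₗ[k] SymPow k V t from h) ∘ₗ
      LinearMap.mulLeft k (ExteriorAlgebra.ι k (b.coord i))
  map_add' h h' := by
    refine Eq.trans ?_ Finset.sum_add_distrib
    exact Finset.sum_congr rfl fun i _ => by
      ext a
      exact congrArg Subtype.val (map_add (symPowMul t (b i)) _ _)
  map_smul' c h := by
    ext a
    simp only [RingHom.id_apply]
    erw [LinearMap.sum_apply, LinearMap.sum_apply]
    congr 1
    refine Finset.sum_congr rfl fun i _ => ?_
    change symPowMul t (b i) (h (_ * _ * c)) = symPowMul t (b i) (h (_ * (_ * c)))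
    rw [mul_assoc]

theorem koszulD_apply (t : ℕ) (h : KoszulTerm k V t) (a : DualExt k V) :
    koszulD b t h a =
      ∑ i, symPowMul t (b i) (h (ExteriorAlgebra.ι k (b.coord i) * a)) :=
  LinearMap.sum_apply _ _ _

theorem koszulD_koszulD (t : ℕ) (h : KoszulTerm k V t) :
    koszulD b (t + 1) (koszulD b t h) = 0 := by
  classical
  ext1 a
  simp only [koszulD_apply, map_sum, CofreeModule.zero_apply, ← mul_assoc]
  rw [← Finset.sum_product']
  refine Finset.sum_involution (fun p _ => p.swap) ?_ ?_ (by simp) (by simp)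
  · rintro ⟨i, j⟩ -
    rw [Prod.swap, symPowMul_comm, ← map_add, ← map_add, ← map_add, ← add_mul,
      ExteriorAlgebra.ι_add_mul_swap]
    simp
  · rintro ⟨i, j⟩ - hij h
    obtain rfl : j = i := congrArg Prod.fst h
    exact hij (by simp)

/-- On cocycles, subtracting the coboundary of the contraction in the direction of `v_i` replaces
`z(a)` by `z(v_i ⌟ (φ_i a))` and removes all multiples of `v_i` from it. -/
theorem sub_koszulD_koszulHomotopy_apply (i : ι) (t : ℕ) (z : KoszulTerm k V (t + 1))
    (hz : koszulD b (t + 1) z = 0) (a : DualExt k V) :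
    (z - koszulD b t (koszulHomotopy b i t z)) a =
      z (CliffordAlgebra.contractLeft (Q := 0) (Module.Dual.eval k V (b i))
          (ExteriorAlgebra.ι k (b.coord i) * a)) -
        symPowMul t (b i) (symPowDiv b i t
          (z (CliffordAlgebra.contractLeft (Q := 0) (Module.Dual.eval k V (b i))
            (ExteriorAlgebra.ι k (b.coord i) * a)))) := by
  classical
  set w := CliffordAlgebra.contractLeft (Q := 0) (Module.Dual.eval k V (b i)) a with hw
  -- The cocycle condition at `w`, divided by `v_i`, gives the terms with `j ≠ i` of the coboundary.
  have h₀ : symPowDiv b i (t + 1) (koszulD b (t + 1) z w) = 0 := by rw [hz]; simp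
  rw [koszulD_apply, map_sum, ← Finset.add_sum_erase _ _ (Finset.mem_univ i),
    symPowDiv_symPowMul_self] at h₀
  rw [CofreeModule.sub_apply, koszulD_apply, ← Finset.add_sum_erase _ _ (Finset.mem_univ i)]
  simp only [koszulHomotopy_apply]
  have h₁ : ∑ j ∈ Finset.univ.erase i, symPowMul t (b j) (symPowDiv b i t
        (z (CliffordAlgebra.contractLeft (Q := 0) (Module.Dual.eval k V (b i))
          (ExteriorAlgebra.ι k (b.coord j) * a)))) =
      - ∑ j ∈ Finset.univ.erase i, symPowDiv b i (t + 1)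
        (symPowMul (t + 1) (b j) (z (ExteriorAlgebra.ι k (b.coord j) * w))) := by
    rw [← Finset.sum_neg_distrib]
    refine Finset.sum_congr rfl fun j hj => ?_
    have hij : i ≠ j := (Finset.ne_of_mem_erase hj).symm
    rw [contractLeft_coord_mul_of_ne b hij, symPowDiv_symPowMul_of_ne b hij, map_neg, map_neg,
      map_neg]
  rw [h₁, ← eq_neg_of_add_eq_zero_left h₀, contractLeft_coord_mul_self, ← hw, map_sub z]
  abel

/-- Exactness of the Koszul resolution in positive degrees. A cocycle is changed by coboundaries,
one basis vector at a time, until no monomial is left in its values. -/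
theorem exists_koszulD_eq (t : ℕ) (z : KoszulTerm k V (t + 1)) (hz : koszulD b (t + 1) z = 0) :
    ∃ y, koszulD b t y = z := by
  classical
  have key : ∀ s : Finset ι, ∃ y, ∀ i ∈ s, ∀ a,
      FreeOfBasisVector b i ((z - koszulD b t y) a) := by
    intro s
    induction s using Finset.induction_on with
    | empty => exact ⟨0, by simp⟩
    | insert i s _ ih =>
      obtain ⟨y, hy⟩ := ih
      set z' := z - koszulD b t y with hz'
      have hdz' : koszulD b (t + 1) z' = 0 := by
        rw [hz', map_sub, hz, koszulD_koszulD, sub_zero]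
      refine ⟨y + koszulHomotopy b i t z', fun j hj a => ?_⟩
      rw [map_add, ← sub_sub, ← hz', sub_koszulD_koszulHomotopy_apply b i t z' hdz']
      rcases Finset.mem_insert.mp hj with rfl | hj
      · exact freeOfBasisVector_sub_self b j t _
      · exact (hy j hj _).sub b
  obtain ⟨y, hy⟩ := key Finset.univ
  refine ⟨y, (sub_eq_zero.mp (CofreeModule.ext fun a => ?_)).symm⟩
  exact eq_zero_of_forall_freeOfBasisVector b fun i => hy i (Finset.mem_univ i) a

/-- Exactness of the Koszul resolution in degree zero: the kernel of the differential on
`Hom_k(∧(V^*), S^0 V)` consists of the multiples of the augmentation. -/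
theorem eq_aug_smul_of_koszulD_zero (z : KoszulTerm k V 0) (hz : koszulD b 0 z = 0)
    (a : DualExt k V) : z a = dualExtAug k V a • z 1 := by
  classical
  refine eq_aug_smul_of_ι_mul_eq_zero (show DualExt k V →ₗ[k] SymPow k V 0 from z)
    (fun φ a => ?_) a
  change z _ = 0
  -- Dividing the cocycle condition by `v_i` isolates one summand, since `z` has constant values.
  have h (i : ι) : z (ExteriorAlgebra.ι k (b.coord i) * a) = 0 := by
    have h₀ : symPowDiv b i 0 (koszulD b 0 z a) = 0 := by rw [hz]; simp
    rwa [koszulD_apply, map_sum, Finset.sum_eq_single i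
      (fun j _ hj => symPowDiv_symPowMul_zero_of_ne b hj.symm _) (by simp),
      symPowDiv_symPowMul_self] at h₀
  have hφ : φ = ∑ i, φ (b i) • b.coord i := by
    refine b.ext fun j => ?_
    simp
  rw [hφ, map_sum, Finset.sum_mul, map_sum]
  refine Finset.sum_eq_zero fun i _ => ?_
  rw [map_smul, smul_mul_assoc, map_smul, h, smul_zero]

/-- The functoriality of the Koszul resolution in `V`: `h ↦ S^t(f) ∘ h ∘ ∧(f^*)`. -/
def koszulMap (f : V →ₗ[k] W) (t : ℕ) (h : KoszulTerm k V t) : KoszulTerm k W t :=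
  symPowMap f t ∘ₗ (show DualExt k V →ₗ[k] SymPow k V t from h) ∘ₗ (dualExtMap f).toLinearMap

theorem koszulMap_apply (f : V →ₗ[k] W) (t : ℕ) (h : KoszulTerm k V t) (a : DualExt k W) :
    koszulMap f t h a = symPowMap f t (h (dualExtMap f a)) := rfl

theorem koszulMap_add (f : V →ₗ[k] W) (t : ℕ) (h h' : KoszulTerm k V t) :
    koszulMap f t (h + h') = koszulMap f t h + koszulMap f t h' :=
  CofreeModule.ext fun a => by simp [koszulMap_apply]

theorem koszulMap_smul (f : V →ₗ[k] W) (t : ℕ) (c : DualExt k W) (h : KoszulTerm k V t) :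
    koszulMap f t (dualExtMap f c • h) = c • koszulMap f t h :=
  CofreeModule.ext fun a => by simp [koszulMap_apply]

/-- The differential does not depend on bases: both sides contract against the canonical element
of `W ⊗ V^*` given by `f`. -/
theorem koszulD_koszulMap {κ : Type*} [Fintype κ] (b' : Module.Basis κ k W) (f : V →ₗ[k] W)
    (t : ℕ) (h : KoszulTerm k V t) :
    koszulD b' t (koszulMap f t h) = koszulMap f (t + 1) (koszulD b t h) := by
  classical
  ext1 a
  simp only [koszulD_apply, koszulMap_apply, map_sum, map_mul, symPowMap_symPowMul,
    ExteriorAlgebra.map_apply_ι]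
  have h₁ (j : κ) : f.dualMap (b'.coord j) = ∑ i, b'.coord j (f (b i)) • b.coord i := by
    refine b.ext fun i => ?_
    simp [Finsupp.single_apply]
  have h₂ (i : ι) : f (b i) = ∑ j, b'.coord j (f (b i)) • b' j := by
    simp [b'.sum_repr]
  simp_rw [h₁]
  conv_rhs => enter [2, i]; rw [h₂]
  simp only [map_sum, map_smul, Finset.sum_mul, smul_mul_assoc, LinearMap.sum_apply,
    LinearMap.smul_apply]
  exact Finset.sum_comm

end Koszul

/-! ### Dimension shifting along the Koszul resolution -/

section KoszulExt

variable {k V : Type u} [Field k] [AddCommGroup V] [Module k V]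

variable (k V) in
/-- The element `1` of the trivial module. -/
def trivialModuleOne : trivialModule k V := show k from 1

theorem eq_algebraMap_smul_trivialModuleOne (c : trivialModule k V) :
    c = algebraMap k (DualExt k V) (show k from c) • trivialModuleOne k V :=
  ((congrArg (· * (1 : k)) ((dualExtAug k V).commutes (show k from c))).trans
    (mul_one (show k from c))).symm

/-- The function `a ↦ ε(a) s` on `∧(V^*)`, where `ε` is the augmentation. -/
def augSMul {t : ℕ} (s : SymPow k V t) : KoszulTerm k V t :=
  (dualExtAug k V).toLinearMap.smulRight s

theorem augSMul_apply {t : ℕ} (s : SymPow k V t) (a : DualExt k V) :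
    augSMul s a = dualExtAug k V a • s := rfl

/-- The socle of `Hom_k(∧(V^*), S^t V)`: maps from the trivial module have values in multiples of
the augmentation. -/
theorem trivialModule_map_eq_augSMul {t : ℕ}
    (g : trivialModule k V →ₗ[DualExt k V] KoszulTerm k V t) (c : trivialModule k V) :
    g c = augSMul (g c 1) := by
  refine CofreeModule.ext fun a => ?_
  refine eq_aug_smul_of_mul_ι_eq_zero (show DualExt k V →ₗ[k] SymPow k V t from g c)
    (fun φ a => ?_) a
  have h : ExteriorAlgebra.ι k φ • c = 0 := by
    change dualExtAug k V (ExteriorAlgebra.ι k φ) * (show k from c) = 0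
    simp only [ExteriorAlgebra.algebraMapInv, ExteriorAlgebra.lift_ι_apply, LinearMap.zero_apply]
    exact zero_mul _
  change (ExteriorAlgebra.ι k φ • g c) a = 0
  rw [← map_smul, h, map_zero, CofreeModule.zero_apply]

variable (k V) [FiniteDimensional k V]

/-- The submodule of cocycles of degree `t` in the Koszul resolution. The basis `Module.finBasis` is
an arbitrary choice, on which the differential does not depend. -/
def koszulCocycles (t : ℕ) : Submodule (DualExt k V) (KoszulTerm k V t) :=
  LinearMap.ker (koszulD (Module.finBasis k V) t)

/-- The short exact sequence `0 → Z_t → Hom_k(∧(V^*), S^t V) → Z_{t+1} → 0` formed with the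
cocycles of the Koszul resolution. -/
def koszulShortComplex (t : ℕ) : ShortComplex (ModuleCat.{u} (DualExt k V)) where
  X₁ := ModuleCat.of _ (koszulCocycles k V t)
  X₂ := ModuleCat.of _ (KoszulTerm k V t)
  X₃ := ModuleCat.of _ (koszulCocycles k V (t + 1))
  f := ModuleCat.ofHom (koszulCocycles k V t).subtype
  g := ModuleCat.ofHom ((koszulD (Module.finBasis k V) t).codRestrict _
    fun h => koszulD_koszulD (Module.finBasis k V) t h)
  zero := by
    refine ModuleCat.hom_ext (LinearMap.ext fun z => ?_)
    exact Subtype.ext z.2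

theorem koszulShortComplex_shortExact (t : ℕ) : (koszulShortComplex k V t).ShortExact := by
  refine ModuleCat.shortComplex_shortExact _ (fun h => ?_) Subtype.val_injective ?_
  · refine ⟨fun hh => ⟨⟨h, congrArg Subtype.val hh⟩, rfl⟩, ?_⟩
    rintro ⟨z, rfl⟩
    exact Subtype.ext z.2
  · rintro ⟨z, hz⟩
    obtain ⟨y, hy⟩ := exists_koszulD_eq (Module.finBasis k V) t z hz
    exact ⟨y, Subtype.ext hy⟩

instance (t : ℕ) : Injective (koszulShortComplex k V t).X₂ :=
  Module.injective_object_of_injective_module (DualExt k V) (KoszulTerm k V t)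

variable {k V}

theorem augSMul_mem_koszulCocycles {t : ℕ} (s : SymPow k V t) :
    augSMul s ∈ koszulCocycles k V t := by
  refine CofreeModule.ext fun a => ?_
  rw [koszulD_apply]
  exact Finset.sum_eq_zero fun i _ => by simp [augSMul_apply, ExteriorAlgebra.algebraMapInv]

/-- A map from the trivial module to a term of the resolution has values in cocycles. -/
theorem trivialModule_comp_g_eq_zero {t : ℕ}
    (u : trivialModule k V ⟶ (koszulShortComplex k V t).X₂) :
    u ≫ (koszulShortComplex k V t).g = 0 := by
  refine ModuleCat.hom_ext (LinearMap.ext fun c => ?_)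
  refine Subtype.ext ?_
  let g : trivialModule k V →ₗ[DualExt k V] KoszulTerm k V t := u.hom
  change g c ∈ koszulCocycles k V t
  rw [trivialModule_map_eq_augSMul g c]
  exact augSMul_mem_koszulCocycles _

/-- Homomorphisms from the trivial module to the cocycles of degree `t` form the space `S^t V`. -/
def symPowEquivHom (t : ℕ) :
    SymPow k V t ≃ₗ[k] (trivialModule k V ⟶ ModuleCat.of _ (koszulCocycles k V t)) where
  toFun s := ModuleCat.ofHom (X := trivialModule k V)
    { toFun c := ⟨augSMul ((show k from c) • s), augSMul_mem_koszulCocycles _⟩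
      map_add' c c' := Subtype.ext <| CofreeModule.ext fun a => by
        change dualExtAug k V a • ((show k from c) + (show k from c')) • s =
          dualExtAug k V a • (show k from c) • s + dualExtAug k V a • (show k from c') • s
        rw [add_smul, smul_add]
      map_smul' x c := Subtype.ext <| CofreeModule.ext fun a => by
        change dualExtAug k V a • (dualExtAug k V x * (show k from c)) • s =
          dualExtAug k V (a * x) • (show k from c) • s
        rw [map_mul, smul_smul, smul_smul, mul_assoc] }
  map_add' s s' := by
    refine ModuleCat.hom_ext (LinearMap.ext fun c => ?_)
    refine Subtype.ext <| CofreeModule.ext fun a => ?_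
    change dualExtAug k V a • (show k from c) • (s + s') =
      dualExtAug k V a • (show k from c) • s + dualExtAug k V a • (show k from c) • s'
    rw [smul_add, smul_add]
  map_smul' r s := by
    refine ModuleCat.hom_ext (LinearMap.ext fun c => ?_)
    refine Subtype.ext <| CofreeModule.ext fun a => ?_
    change dualExtAug k V a • (show k from c) • (r • s) =
      dualExtAug k V (a * algebraMap k _ r) • (show k from c) • s
    rw [map_mul, AlgHom.commutes, smul_smul, smul_smul, smul_smul]
    congr 1
    exact mul_right_comm (dualExtAug k V a) (show k from c) r
  invFun g := (g.hom (trivialModuleOne k V)).1 1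
  left_inv s := by
    change dualExtAug k V 1 • (1 : k) • s = s
    simp
  right_inv g := by
    refine ModuleCat.hom_ext (LinearMap.ext fun c => ?_)
    refine Subtype.ext <| CofreeModule.ext fun a => ?_
    let g' : trivialModule k V →ₗ[DualExt k V] KoszulTerm k V t :=
      (koszulCocycles k V t).subtype ∘ₗ g.hom
    have h₁ := trivialModule_map_eq_augSMul g' c
    have h₂ : g' c 1 = (show k from c) • g' (trivialModuleOne k V) 1 := by
      conv_lhs => rw [eq_algebraMap_smul_trivialModuleOne (k := k) (V := V) c, map_smul]
      exact CofreeModule.algebraMap_smul_apply_one (k := k) (show k from c)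
        (g' (trivialModuleOne k V))
    change dualExtAug k V a • (show k from c) • g' (trivialModuleOne k V) 1 = g' c a
    rw [h₁, ← h₂]
    rfl

theorem symPowEquivHom_apply {t : ℕ} (s : SymPow k V t) (c : trivialModule k V) :
    ((symPowEquivHom t s).hom c).1 = augSMul ((show k from c) • s) := rfl

variable (k V) in
/-- The homomorphism `k → Z_0` given by `1 ∈ S^0 V` is bijective: exactness in degree zero. -/
theorem symPowEquivHom_symPowZeroEquiv_one_bijective :
    Function.Bijective (symPowEquivHom 0 (symPowZeroEquiv k V 1)).hom := by
  have h (c : trivialModule k V) (a : DualExt k V) :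
      ((symPowEquivHom 0 (symPowZeroEquiv k V 1)).hom c).1 a =
        dualExtAug k V a • symPowZeroEquiv k V c := by
    rw [symPowEquivHom_apply, augSMul_apply, ← map_smul (symPowZeroEquiv k V), smul_eq_mul,
      mul_one]
  constructor
  · intro c c' hc
    have hc := (h c 1).symm.trans ((congrArg (fun z => z.1 1) hc).trans (h c' 1))
    rw [map_one, one_smul, one_smul] at hc
    exact (symPowZeroEquiv k V).injective hc
  · intro z
    obtain ⟨c, hc⟩ := (symPowZeroEquiv k V).surjective (z.1 1)
    refine ⟨c, Subtype.ext <| CofreeModule.ext fun a => (h c a).trans ?_⟩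
    rw [eq_aug_smul_of_koszulD_zero (Module.finBasis k V) z.1 z.2 a, ← hc]

variable (k V) in
/-- The cocycles of degree zero are the trivial module. -/
def trivialModuleIsoKoszulCocycles :
    trivialModule k V ≅ ModuleCat.of _ (koszulCocycles k V 0) :=
  (LinearEquiv.ofBijective (symPowEquivHom 0 (symPowZeroEquiv k V 1)).hom
    (symPowEquivHom_symPowZeroEquiv_one_bijective k V)).toModuleIso

variable (k V) in
/-- The extension class in `Ext^1(Z_{t+1}, Z_t)` of one step of the Koszul resolution. -/
def koszulExtClass (t : ℕ) :
    Abelian.Ext.{u} (ModuleCat.of (DualExt k V) (koszulCocycles k V (t + 1)))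
      (ModuleCat.of (DualExt k V) (koszulCocycles k V t)) 1 :=
  (koszulShortComplex_shortExact k V t).extClass

variable (k V) in
/-- The class in `Ext^t(Z_t, k)` of the truncated Koszul resolution
`0 → k → I_0 → ⋯ → I_{t-1} → Z_t → 0`. -/
def koszulClass : ∀ t : ℕ,
    Abelian.Ext.{u} (ModuleCat.of (DualExt k V) (koszulCocycles k V t)) (trivialModule k V) t
  | 0 => Abelian.Ext.mk₀ (trivialModuleIsoKoszulCocycles k V).inv
  | t + 1 => (koszulExtClass k V t).comp (koszulClass t) (add_comm 1 t)

/-- Dimension shifting along one step of the Koszul resolution, including degree zero. -/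
theorem comp_koszulShortComplex_extClass_bijective (t i : ℕ) :
    Function.Bijective
      fun x : Abelian.Ext.{u} (trivialModule k V) (koszulShortComplex k V t).X₃ i =>
        x.comp (koszulShortComplex_shortExact k V t).extClass (rfl : i + 1 = i + 1) := by
  constructor
  · refine (injective_iff_map_eq_zero ((koszulShortComplex_shortExact k V t).extClass.postcomp
      (trivialModule k V) rfl)).mpr fun x hx => ?_
    obtain ⟨y, rfl⟩ := Abelian.Ext.covariant_sequence_exact₃ _
      (koszulShortComplex_shortExact k V t) x rfl hx
    cases i with
    | zero =>
      -- `Hom(k, I_t)` does not vanish, but its map to `Hom(k, Z_{t+1})` does.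
      obtain ⟨u, rfl⟩ := (Abelian.Ext.mk₀_bijective _ _).2 y
      rw [Abelian.Ext.mk₀_comp_mk₀, trivialModule_comp_g_eq_zero, Abelian.Ext.mk₀_zero]
    | succ i => rw [Abelian.Ext.eq_zero_of_injective y, Abelian.Ext.zero_comp]
  · intro y
    exact Abelian.Ext.covariant_sequence_exact₁ _ (koszulShortComplex_shortExact k V t) y
      (Abelian.Ext.eq_zero_of_injective _) rfl

theorem comp_koszulClass_bijective (t i n : ℕ) (h : i + t = n) :
    Function.Bijective fun x : Abelian.Ext.{u} (trivialModule k V)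
      (ModuleCat.of (DualExt k V) (koszulCocycles k V t)) i => x.comp (koszulClass k V t) h := by
  induction t generalizing i with
  | zero =>
    obtain rfl : i = n := h
    refine Function.bijective_iff_has_inverse.mpr
      ⟨fun x => x.comp (Abelian.Ext.mk₀ (trivialModuleIsoKoszulCocycles k V).hom) (add_zero i),
        fun x => ?_, fun x => ?_⟩ <;>
    simp [koszulClass]
  | succ t ih =>
    have h' := (ih (i + 1) (by omega)).comp
      (comp_koszulShortComplex_extClass_bijective (k := k) (V := V) t i)
    refine (congrArg Function.Bijective (funext fun x => ?_)).mp h'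
    exact Abelian.Ext.comp_assoc x _ _ rfl (add_comm 1 t) (by omega)

variable (k V) in
/-- The isomorphism `S^t V ≃ Ext^t(k, k)` over `∧(V^*)`: an element of `S^t V`, viewed as a
homomorphism `k → Z_t`, is composed with the class of the truncated Koszul resolution. -/
def symPowEquivExt (t : ℕ) : SymPow k V t ≃ₗ[k] ExtTriv k V t :=
  (symPowEquivHom t).trans <| Abelian.Ext.linearEquiv₀.symm.trans <|
    LinearEquiv.ofBijective
      ((koszulClass k V t).postcompOfLinear k (trivialModule k V) (zero_add t))
      (comp_koszulClass_bijective t 0 t (zero_add t))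

theorem symPowEquivExt_apply (t : ℕ) (s : SymPow k V t) :
    symPowEquivExt k V t s =
      (Abelian.Ext.mk₀ (symPowEquivHom t s)).comp (koszulClass k V t) (zero_add t) := rfl

end KoszulExt

/-! ### Naturality in the vector space -/

section Naturality

variable {k V W : Type u} [Field k] [AddCommGroup V] [Module k V] [AddCommGroup W] [Module k W]
  (f : V →ₗ[k] W)

theorem koszulMap_augSMul {t : ℕ} (s : SymPow k V t) :
    koszulMap f t (augSMul s) = augSMul (symPowMap f t s) := by
  refine CofreeModule.ext fun a => ?_
  rw [koszulMap_apply, augSMul_apply, augSMul_apply, map_smul]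
  congr 1
  exact (RingHom.congr_fun (dualExtAug_comp_map f) a).symm

variable [FiniteDimensional k V] [FiniteDimensional k W]

/-- The map induced by `V → W` on the terms of the Koszul resolutions, as a homomorphism of
`∧(W^*)`-modules. -/
def koszulTermHom (t : ℕ) :
    (ModuleCat.restrictScalars (dualExtMap f).toRingHom).obj
      (ModuleCat.of (DualExt k V) (KoszulTerm k V t)) ⟶
        ModuleCat.of (DualExt k W) (KoszulTerm k W t) :=
  ModuleCat.ofHom (X := (ModuleCat.restrictScalars (dualExtMap f).toRingHom).obj
      (ModuleCat.of (DualExt k V) (KoszulTerm k V t)))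
    { toFun := koszulMap f t
      map_add' := koszulMap_add f t
      map_smul' := koszulMap_smul f t }

/-- The map induced by `V → W` on the cocycles of the Koszul resolutions, as a homomorphism of
`∧(W^*)`-modules. -/
def koszulCocyclesHom (t : ℕ) :
    (ModuleCat.restrictScalars (dualExtMap f).toRingHom).obj
      (ModuleCat.of (DualExt k V) (koszulCocycles k V t)) ⟶
        ModuleCat.of (DualExt k W) (koszulCocycles k W t) :=
  ModuleCat.ofHom (X := (ModuleCat.restrictScalars (dualExtMap f).toRingHom).obj
      (ModuleCat.of (DualExt k V) (koszulCocycles k V t)))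
    { toFun z := ⟨koszulMap f t z.1, by
        refine (koszulD_koszulMap (Module.finBasis k V) (Module.finBasis k W) f t z.1).trans ?_
        rw [show koszulD (Module.finBasis k V) t z.1 = 0 from z.2]
        exact CofreeModule.ext fun a => by simp [koszulMap_apply]⟩
      map_add' z z' := Subtype.ext (koszulMap_add f t z.1 z'.1)
      map_smul' c z := Subtype.ext (koszulMap_smul f t c z.1) }

/-- The morphism of short exact sequences of cocycles induced by `V → W`. -/
def koszulShortComplexHom (t : ℕ) :
    (koszulShortComplex k V t).map (ModuleCat.restrictScalars (dualExtMap f).toRingHom) ⟶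
      koszulShortComplex k W t where
  τ₁ := koszulCocyclesHom f t
  τ₂ := koszulTermHom f t
  τ₃ := koszulCocyclesHom f (t + 1)
  comm₁₂ := rfl
  comm₂₃ := by
    ext h
    exact Subtype.ext
      (koszulD_koszulMap (Module.finBasis k V) (Module.finBasis k W) f t h)

/-- Naturality of `S^t V = Hom(k, Z_t)`. -/
theorem trivialModuleIso_comp_symPowEquivHom (t : ℕ) (s : SymPow k V t) :
    (trivialModuleIso f).hom ≫
      (ModuleCat.restrictScalars (dualExtMap f).toRingHom).map (symPowEquivHom t s) ≫
        koszulCocyclesHom f t = symPowEquivHom t (symPowMap f t s) := by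
  refine ModuleCat.hom_ext (LinearMap.ext fun c => ?_)
  refine Subtype.ext ?_
  change koszulMap f t (augSMul ((show k from c) • s)) = augSMul (_ • symPowMap f t s)
  rw [koszulMap_augSMul, map_smul]

theorem map_trivialModuleIsoKoszulCocycles_inv :
    (ModuleCat.restrictScalars (dualExtMap f).toRingHom).map
        (trivialModuleIsoKoszulCocycles k V).inv ≫ (trivialModuleIso f).inv =
      koszulCocyclesHom f 0 ≫ (trivialModuleIsoKoszulCocycles k W).inv := by
  have h := trivialModuleIso_comp_symPowEquivHom f 0 (symPowZeroEquiv k V 1)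
  rw [symPowMap_symPowZeroEquiv] at h
  change (trivialModuleIso f).hom ≫
      (ModuleCat.restrictScalars (dualExtMap f).toRingHom).map
        (trivialModuleIsoKoszulCocycles k V).hom ≫ koszulCocyclesHom f 0 =
    (trivialModuleIsoKoszulCocycles k W).hom at h
  rw [Iso.eq_comp_inv, ← h]
  rw [Category.assoc, Iso.inv_hom_id_assoc, ← Functor.map_comp_assoc, Iso.inv_hom_id]
  exact (congrArg (· ≫ koszulCocyclesHom f 0) (CategoryTheory.Functor.map_id _ _)).trans
    (Category.id_comp _)

theorem koszulExtClass_naturality (t : ℕ) :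
    ((koszulExtClass k V t).mapExactFunctor
      (ModuleCat.restrictScalars (dualExtMap f).toRingHom)).comp
        (Abelian.Ext.mk₀ (koszulCocyclesHom f t)) (add_zero 1) =
      (Abelian.Ext.mk₀ (koszulCocyclesHom f (t + 1))).comp (koszulExtClass k W t)
        (zero_add 1) := by
  have h := ((koszulShortComplex_shortExact k V t).map_of_exact
    (ModuleCat.restrictScalars (dualExtMap f).toRingHom)).extClass_naturality
    (koszulShortComplex_shortExact k W t) (koszulShortComplexHom f t)
  rw [← Abelian.Ext.mapExactFunctor_extClass] at h
  exact h

/-- The classes of the truncated Koszul resolutions correspond under restriction of scalars. -/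
theorem koszulClass_naturality (t : ℕ) :
    ((koszulClass k V t).mapExactFunctor
      (ModuleCat.restrictScalars (dualExtMap f).toRingHom)).comp
        (Abelian.Ext.mk₀ (trivialModuleIso f).inv) (add_zero t) =
      (Abelian.Ext.mk₀ (koszulCocyclesHom f t)).comp (koszulClass k W t) (zero_add t) := by
  induction t with
  | zero =>
    rw [koszulClass, koszulClass, Abelian.Ext.mapExactFunctor_mk₀, Abelian.Ext.mk₀_comp_mk₀,
      Abelian.Ext.mk₀_comp_mk₀, map_trivialModuleIsoKoszulCocycles_inv]
  | succ t ih =>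
    rw [koszulClass, koszulClass, Abelian.Ext.mapExactFunctor_comp,
      Abelian.Ext.comp_assoc_of_third_deg_zero, ih,
      ← Abelian.Ext.comp_assoc_of_second_deg_zero, koszulExtClass_naturality,
      Abelian.Ext.comp_assoc _ _ _ (zero_add 1) (add_comm 1 t) (by omega)]

theorem extTrivMap_symPowEquivExt (t : ℕ) (s : SymPow k V t) :
    extTrivMap f t (symPowEquivExt k V t s) = symPowEquivExt k W t (symPowMap f t s) := by
  rw [symPowEquivExt_apply, symPowEquivExt_apply, extTrivMap, Abelian.Ext.mapExactFunctor_comp,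
    Abelian.Ext.mapExactFunctor_mk₀, Abelian.Ext.comp_assoc_of_third_deg_zero,
    koszulClass_naturality, Abelian.Ext.mk₀_comp_mk₀_assoc, Abelian.Ext.mk₀_comp_mk₀_assoc,
    Category.assoc, trivialModuleIso_comp_symPowEquivHom]

end Naturality

end

theorem mainTheorem4 (k : Type u) [Field k] (t : ℕ) :
    ∃ e : ∀ (V : Type u) [AddCommGroup V] [Module k V] [FiniteDimensional k V],
        ExtTriv k V t ≃ₗ[k] SymPow k V t,
      ∀ (V W : Type u) [AddCommGroup V] [Module k V] [FiniteDimensional k V]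
        [AddCommGroup W] [Module k W] [FiniteDimensional k W]
        (f : V →ₗ[k] W) (x : ExtTriv k V t),
        e W (extTrivMap f t x) = symPowMap f t (e V x) := by
  refine ⟨fun V _ _ _ => (symPowEquivExt k V t).symm, fun V W _ _ _ _ _ _ f x => ?_⟩
  obtain ⟨s, rfl⟩ := (symPowEquivExt k V t).surjective x
  rw [extTrivMap_symPowEquivExt, LinearEquiv.symm_apply_apply, LinearEquiv.symm_apply_apply]
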